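/- A directed co-expression is built from single vertices $\bullet_v$ (the digraph $(\{v\},\emptyset)$) by three binary operations, each applied to vertex-disjoint digraphs $A,B$: the disjoint union $A\oplus B$; the order composition $A\oslash B$, which is the disjoint union together with all edges directed from $V(A)$ to $V(B)$; and the series composition $A\otimes B$, which is the disjoint union together with all edges between $V(A)$ and $V(B)$ in both directions. The digraphs obtained in this way are the directed co-graphs. The size $|X|$ of a co-expression $X$ is the number of occurrences of vertices and operations in it. Let $G$ be a digraph and $T\subseteq V(G)$ a set of terminal vertices. A directed Steiner path cover of $G$ with respect to $T$ is a set $C$ of pairwise vertex-disjoint simple directed paths of $G$ (each with at least one vertex) which together contain all vertices of $T$. Let $|C|$ be the number of paths and $s(C)$ the number of vertices on the paths of $C$ that are not in $T$. Claim: the value $$\min\{\,|C|+s(C) : C \text{ is a directed Steiner path cover of } G \text{ with respect to } T\,\}$$ for a directed co-graph $G$ can be computed in time linear in the size of the directed co-expression. Precisely: there are a constant $c$ and one random access machine program (its instructions: load a constant, copy a register, addition, truncated subtraction, indirect load and store, jump, jump if zero, halt; each takes unit time) such that the following holds for every co-expression $X$ of a directed co-graph $G$ whose vertices are natural numbers,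 every $T\subseteq V(G)$ and every $N\ge\max V(G)$. Started on the input consisting of $|T|$, a list of the elements of $T$ in any order without repetition, and $X$ in fully parenthesized infix notation (one machine word per symbol), the program halts after at most $c\,|X|$ steps, using only machine words with values in $\{0,\dots,c\,(|X|+N)\}$, and outputs this minimum. -/

import Mathlib

/-! ### Finite digraphs and their compositions -/

/-- A finite digraph whose vertices are drawn from the type `V`. -/
structure FinDigraph (V : Type*) where
  /-- the vertex set -/
  verts : Finset V
  /-- `Adj u v` says that `(u, v)` is a directed edge -/
  Adj : V → V → Prop
  adj_mem : ∀ {u v : V}, Adj u v → u ∈ verts ∧ v ∈ verts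

namespace FinDigraph

variable {V : Type*} [DecidableEq V]

/-- The digraph `({v}, ∅)`. -/
def single (v : V) : FinDigraph V where
  verts := {v}
  Adj _ _ := False
  adj_mem h := h.elim

/-- The disjoint union `A ⊕ B` (used for vertex-disjoint `A` and `B`). -/
def disjUnion (A B : FinDigraph V) : FinDigraph V where
  verts := A.verts ∪ B.verts
  Adj u v := A.Adj u v ∨ B.Adj u v
  adj_mem := by
    rintro u v (h | h)
    · exact ⟨Finset.mem_union_left _ (A.adj_mem h).1, Finset.mem_union_left _ (A.adj_mem h).2⟩
    · exact ⟨Finset.mem_union_right _ (B.adj_mem h).1, Finset.mem_union_right _ (B.adj_mem h).2⟩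

/-- The order composition `A ⊘ B`: the disjoint union together with all edges directed from
`V(A)` to `V(B)`. -/
def orderComp (A B : FinDigraph V) : FinDigraph V where
  verts := A.verts ∪ B.verts
  Adj u v := (disjUnion A B).Adj u v ∨ (u ∈ A.verts ∧ v ∈ B.verts)
  adj_mem := by
    rintro u v (h | h)
    · exact (disjUnion A B).adj_mem h
    · exact ⟨Finset.mem_union_left _ h.1, Finset.mem_union_right _ h.2⟩

/-- The series composition `A ⊗ B`: the disjoint union together with all edges between `V(A)`
and `V(B)`, in both directions. -/
def seriesComp (A B : FinDigraph V) : FinDigraph V where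
  verts := A.verts ∪ B.verts
  Adj u v := (disjUnion A B).Adj u v ∨ (u ∈ A.verts ∧ v ∈ B.verts) ∨
    (u ∈ B.verts ∧ v ∈ A.verts)
  adj_mem := by
    rintro u v (h | h | h)
    · exact (disjUnion A B).adj_mem h
    · exact ⟨Finset.mem_union_left _ h.1, Finset.mem_union_right _ h.2⟩
    · exact ⟨Finset.mem_union_right _ h.1, Finset.mem_union_left _ h.2⟩

/-! ### Directed Steiner path covers -/

/-- A simple directed path of `G`, given by the sequence of its vertices: at least one vertex, no
vertex repeated, consecutive vertices joined by an edge. A path may have length `0`. -/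
def IsSimplePath (G : FinDigraph V) (p : List V) : Prop :=
  p ≠ [] ∧ p.Nodup ∧ (∀ v ∈ p, v ∈ G.verts) ∧ p.IsChain G.Adj

/-- A directed Steiner path cover of `G` with respect to the set `T` of terminal vertices: a set of
pairwise vertex-disjoint simple directed paths of `G` that contain all vertices of `T`. Its size
`|C|` is `C.card`. -/
def IsSteinerPathCover (G : FinDigraph V) (T : Finset V) (C : Finset (List V)) : Prop :=
  (∀ p ∈ C, G.IsSimplePath p) ∧
  (∀ p ∈ C, ∀ q ∈ C, p ≠ q → ∀ v ∈ p, v ∉ q) ∧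
  (∀ t ∈ T, ∃ p ∈ C, t ∈ p)

/-- `s(C)`, the number of Steiner (that is, non-terminal) vertices in the paths of `C`. -/
def steinerCount (T : Finset V) (C : Finset (List V)) : ℕ :=
  ((C.biUnion List.toFinset) \ T).card

end FinDigraph

/-! ### Directed co-expressions -/

/-- Expressions built from single vertices by the three binary operations. -/
inductive CoExpr (V : Type*) where
  /-- the single vertex digraph `•_v` -/
  | vertex (v : V)
  /-- `a ⊕ b` -/
  | union (a b : CoExpr V)
  /-- `a ⊘ b` -/
  | order (a b : CoExpr V)
  /-- `a ⊗ b` -/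
  | series (a b : CoExpr V)

namespace CoExpr

/-- The digraph an expression stands for. -/
def graph {V : Type*} [DecidableEq V] : CoExpr V → FinDigraph V
  | vertex v => FinDigraph.single v
  | union a b => a.graph.disjUnion b.graph
  | order a b => a.graph.orderComp b.graph
  | series a b => a.graph.seriesComp b.graph

/-- Every operation is applied to vertex-disjoint digraphs. The directed co-graphs are exactly the
digraphs `e.graph` of valid expressions `e`. -/
def Valid {V : Type*} [DecidableEq V] : CoExpr V → Prop
  | vertex _ => True
  | union a b => a.Valid ∧ b.Valid ∧ Disjoint a.graph.verts b.graph.verts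
  | order a b => a.Valid ∧ b.Valid ∧ Disjoint a.graph.verts b.graph.verts
  | series a b => a.Valid ∧ b.Valid ∧ Disjoint a.graph.verts b.graph.verts

/-- The size of an expression: the number of occurrences of vertices and operations, that is, the
number of nodes of the corresponding co-tree. -/
def size {V : Type*} : CoExpr V → ℕ
  | vertex _ => 1
  | union a b => a.size + b.size + 1
  | order a b => a.size + b.size + 1
  | series a b => a.size + b.size + 1

/-- The fully parenthesized infix notation of an expression whose vertices are natural numbers,
one machine word per symbol: `0` is `(`, `1` is `)`, `2` is `⊕`, `3` is `⊘`, `4` is `⊗`, and `v + 5`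
is the vertex `v`. -/
def encode : CoExpr ℕ → List ℕ
  | vertex v => [v + 5]
  | union a b => [0] ++ a.encode ++ [2] ++ b.encode ++ [1]
  | order a b => [0] ++ a.encode ++ [3] ++ b.encode ++ [1]
  | series a b => [0] ++ a.encode ++ [4] ++ b.encode ++ [1]

end CoExpr

/-! ### A random access machine with bounded words -/

namespace RAM

/-- Instructions of the machine. Registers hold natural numbers and are addressed directly by their
index; memory cells are addressed by the content of a register. -/
inductive Instr where
  /-- `R i := n` -/
  | const (i n : ℕ)
  /-- `R i := R j` -/
  | copy (i j : ℕ)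
  /-- `R i := R j + R k` -/
  | add (i j k : ℕ)
  /-- `R i := R j - R k`, or `0` if `R j < R k` -/
  | sub (i j k : ℕ)
  /-- `R i := M (R j)` -/
  | load (i j : ℕ)
  /-- `M (R i) := R j` -/
  | store (i j : ℕ)
  /-- continue at instruction `l` -/
  | jump (l : ℕ)
  /-- continue at instruction `l` if `R i = 0` -/
  | jumpZero (i l : ℕ)
  /-- stop -/
  | halt

/-- A configuration: program counter, registers, memory. -/
structure Config where
  /-- the program counter -/
  pc : ℕ
  /-- the contents of the registers -/
  reg : ℕ → ℕ
  /-- the contents of the memory cells -/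
  mem : ℕ → ℕ

/-- Write `n` into register `i` and go on to the next instruction; this fails if `n` exceeds the
largest number `W` that fits into a machine word. -/
def Config.write (W : ℕ) (s : Config) (i n : ℕ) : Option Config :=
  if n ≤ W then some ⟨s.pc + 1, Function.update s.reg i n, s.mem⟩ else none

/-- One step of the machine with program `P` and words holding the numbers `0, …, W`. There is no
next configuration after `halt`, outside the program, or on overflow. -/
def step (W : ℕ) (P : List Instr) (s : Config) : Option Config :=
  match P[s.pc]? with
  | none => none
  | some (.const i n) => s.write W i n
  | some (.copy i j) => s.write W i (s.reg j)
  | some (.add i j k) => s.write W i (s.reg j + s.reg k)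
  | some (.sub i j k) => s.write W i (s.reg j - s.reg k)
  | some (.load i j) => s.write W i (s.mem (s.reg j))
  | some (.store i j) => some ⟨s.pc + 1, s.reg, Function.update s.mem (s.reg i) (s.reg j)⟩
  | some (.jump l) => some ⟨l, s.reg, s.mem⟩
  | some (.jumpZero i l) => some ⟨if s.reg i = 0 then l else s.pc + 1, s.reg, s.mem⟩
  | some .halt => none

/-- The configuration reached after exactly `t` steps, if there is one. -/
def run (W : ℕ) (P : List Instr) : ℕ → Config → Option Config
  | 0, s => some s
  | t + 1, s => (step W P s).bind (run W P t)

/-- The initial configuration: register `0` holds the length of the input, all other registers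
are `0`, and the input stands in the memory cells `0, 1, 2, …`, followed by zeros. -/
def init (input : List ℕ) : Config where
  pc := 0
  reg := Function.update (fun _ => 0) 0 input.length
  mem a := input.getD a 0

/-- With words holding the numbers `0, …, W`, into which the input has to fit, the program `P`
started on `input` reaches a `halt` instruction after at most `t` steps, without overflow, and then
register `0` holds `out`. -/
def OutputsWithin (P : List Instr) (W : ℕ) (input : List ℕ) (t out : ℕ) : Prop :=
  input.length ≤ W ∧ (∀ x ∈ input, x ≤ W) ∧
  ∃ k ≤ t, ∃ s : Config, run W P k (init input) = some s ∧
    P[s.pc]? = some .halt ∧ s.reg 0 = out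

end RAM

/-- The input word sequence for a co-expression `e` and a list `l` of the terminal vertices: the
number of terminals, the terminals, and the expression. -/
def steinerInput (l : List ℕ) (e : CoExpr ℕ) : List ℕ :=
  l.length :: (l ++ e.encode)

/-! ### Path covers as enumerations -/

section PathCount

variable {V : Type*}

/-! Steiner vertices never pay. Deleting a vertex from a path leaves at most two paths, so removing
all Steiner vertices from a cover adds at most `s(C)` paths. The minimum is therefore the path cover
number `p` of the subgraph induced by the terminals.

Path covers are handled as enumerations. Concatenating the paths of a cover gives a repetition-free
list of the terminals with at most that many runs; cutting a list into its maximal runs gives a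
cover. So `p` is the least `pathCount` over all enumerations, and `n` is their common length.

The pair `(p, n)` obeys a recurrence: `p₁ + p₂` for a union, `max p₁ p₂` for an order composition,
and the largest of `p₁ - n₂`, `p₂ - n₁` and `min 1 (n₁ + n₂)` for a series composition, with
truncated subtraction. Lower bounds come from restricting an enumeration to one part (the
`pathCount_filter` lemmas), upper bounds from interleaving two enumerations
(`exists_perm_pathCount_le_max`, `exists_perm_pathCount_le_series`); they meet in
`isCoverData_coverData`.

The machine marks the terminals in a table, then evaluates the recurrence in one scan of the
expression with a stack. Opening parentheses are skipped, and a closing one combines the top two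
values. `Evaluates` is the induction statement: 18 steps per symbol. -/

open Classical in
/-- The number of maximal runs of a list in which consecutive members are related by `r`. -/
noncomputable def pathCount (r : V → V → Prop) : List V → ℕ
  | [] => 0
  | [_] => 1
  | a :: b :: l => pathCount r (b :: l) + if r a b then 0 else 1

variable {r r' : V → V → Prop}

theorem pathCount_cons_cons_of_rel {a b : V} (l : List V) (h : r a b) :
    pathCount r (a :: b :: l) = pathCount r (b :: l) := by
  simp [pathCount, h]

theorem pathCount_cons_cons_of_not_rel {a b : V} (l : List V) (h : ¬ r a b) :
    pathCount r (a :: b :: l) = pathCount r (b :: l) + 1 := by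
  simp [pathCount, h]

theorem pathCount_cons_le (a : V) (l : List V) : pathCount r (a :: l) ≤ pathCount r l + 1 := by
  cases l with
  | nil => simp [pathCount]
  | cons b l => simp only [pathCount]; split_ifs <;> omega

theorem pathCount_le_cons (a : V) (l : List V) : pathCount r l ≤ pathCount r (a :: l) := by
  cases l with
  | nil => simp [pathCount]
  | cons b l => simp only [pathCount]; omega

theorem pathCount_le_length (l : List V) : pathCount r l ≤ l.length := by
  induction l with
  | nil => simp [pathCount]
  | cons a l ih => have := pathCount_cons_le (r := r) a l; simp only [List.length_cons]; omega

theorem pathCount_pos {l : List V} (h : l ≠ []) : 1 ≤ pathCount r l := by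
  induction l with
  | nil => exact absurd rfl h
  | cons a l ih =>
    cases l with
    | nil => simp [pathCount]
    | cons b l => exact (ih (by simp)).trans (pathCount_le_cons a _)

/-- Only pairs of members matter, so counts can be compared between a graph and a part that contains
the whole list. -/
theorem pathCount_anti {l : List V} (h : ∀ a ∈ l, ∀ b ∈ l, r a b → r' a b) :
    pathCount r' l ≤ pathCount r l := by
  induction l with
  | nil => simp [pathCount]
  | cons a l ih =>
    cases l with
    | nil => simp [pathCount]
    | cons b l =>
      have h1 := ih fun x hx y hy => h x (List.mem_cons_of_mem _ hx) y (List.mem_cons_of_mem _ hy)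
      by_cases hr : r a b
      · rw [pathCount_cons_cons_of_rel l hr, pathCount_cons_cons_of_rel l (h a (by simp) b (by simp) hr)]
        exact h1
      · rw [pathCount_cons_cons_of_not_rel l hr]
        exact (pathCount_cons_le a _).trans (by omega)

theorem pathCount_append_le (l l' : List V) :
    pathCount r (l ++ l') ≤ pathCount r l + pathCount r l' := by
  induction l with
  | nil => simp [pathCount]
  | cons a l ih =>
    cases l with
    | nil => have := pathCount_cons_le (r := r) a l'; simpa [pathCount, add_comm] using this
    | cons b l => simp only [pathCount, List.cons_append] at ih ⊢; omega

/-- Appending costs one run less if the two lists can be joined. -/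
theorem pathCount_append_join {l l' : List V} (hl : l ≠ []) (hl' : l' ≠ [])
    (h : ∀ a ∈ l.getLast?, ∀ b ∈ l'.head?, r a b) :
    pathCount r (l ++ l') + 1 ≤ pathCount r l + pathCount r l' := by
  induction l with
  | nil => exact absurd rfl hl
  | cons a l ih =>
    cases l with
    | nil =>
      cases l' with
      | nil => exact absurd rfl hl'
      | cons b l' =>
        have := pathCount_cons_cons_of_rel l' (h a (by simp) b (by simp))
        simp only [List.cons_append, List.nil_append, this]
        simp [pathCount, add_comm]
    | cons b l =>
      have := ih (by simp) fun x hx y hy => h x (by simpa [List.getLast?_cons_cons] using hx) y hy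
      simp only [pathCount, List.cons_append] at this ⊢
      omega

/-- The first run of a list can be split off. -/
theorem exists_run_append {l : List V} (hl : l ≠ []) :
    ∃ p q, p ≠ [] ∧ l = p ++ q ∧ p.IsChain r ∧ pathCount r p = 1 ∧
      pathCount r l = pathCount r q + 1 := by
  induction l with
  | nil => exact absurd rfl hl
  | cons a l ih =>
    cases l with
    | nil => exact ⟨[a], [], by simp, by simp, by simp, by simp [pathCount], by simp [pathCount]⟩
    | cons b l =>
      by_cases hr : r a b
      · obtain ⟨p, q, hp, he, hc, h1, h2⟩ := ih (by simp)
        cases p with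
        | nil => exact absurd rfl hp
        | cons b' p =>
          obtain ⟨rfl, rfl⟩ : b = b' ∧ l = p ++ q := by simpa using he
          refine ⟨a :: b :: p, q, by simp, by simp, ?_, ?_, ?_⟩
          · exact List.isChain_cons_cons.2 ⟨hr, hc⟩
          · rw [pathCount_cons_cons_of_rel p hr, h1]
          · rw [pathCount_cons_cons_of_rel _ hr, h2]
      · exact ⟨[a], b :: l, by simp, by simp, by simp, by simp [pathCount],
          pathCount_cons_cons_of_not_rel l hr⟩

theorem pathCount_of_isChain {p : List V} (h : p.IsChain r) : pathCount r p ≤ 1 := by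
  induction p with
  | nil => simp [pathCount]
  | cons a p ih =>
    cases p with
    | nil => simp [pathCount]
    | cons b p =>
      rw [List.isChain_cons_cons] at h
      rw [pathCount_cons_cons_of_rel p h.1]
      exact ih h.2

/-- The passage from an enumeration to a path cover. -/
theorem exists_runs (l : List V) : ∃ L : List (List V), L.flatten = l ∧
    L.length = pathCount r l ∧ ∀ p ∈ L, p ≠ [] ∧ p.IsChain r := by
  induction h : l.length using Nat.strong_induction_on generalizing l with
  | _ n ih =>
    by_cases hl : l = []
    · exact ⟨[], by simp [hl, pathCount]⟩
    · obtain ⟨p, q, hp, he, hc, -, h2⟩ := exists_run_append (r := r) hl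
      have := List.length_pos_iff.2 hp
      obtain ⟨L, h3, h4, h5⟩ := ih q.length (by rw [← h, he, List.length_append]; omega) q rfl
      refine ⟨p :: L, by simp [h3, he], by simp [h4, h2], ?_⟩
      rintro x hx
      rcases List.mem_cons.1 hx with rfl | hx
      exacts [⟨hp, hc⟩, h5 x hx]

/-- The passage from a path cover to an enumeration. The inequality may be strict, since consecutive
paths may happen to join. -/
theorem pathCount_flatten_le (L : List (List V)) (h : ∀ p ∈ L, p.IsChain r) :
    pathCount r L.flatten ≤ L.length := by
  induction L with
  | nil => simp [pathCount]
  | cons p L ih =>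
    have h1 := pathCount_append_le (r := r) p L.flatten
    have h2 := pathCount_of_isChain (h p (by simp))
    have h3 := ih fun q hq => h q (List.mem_cons_of_mem _ hq)
    simp only [List.flatten_cons, List.length_cons]
    omega

/-! ### Restricting an enumeration -/

variable (P : V → Prop) [DecidablePred P]

/-- A deleted member splits a run only if something precedes it, so a deleted head saves one. This
saving strengthens the induction: it pays for a kept member put in front of a deleted one. -/
theorem pathCount_filter_add (l : List V) :
    pathCount r (l.filter (P ·)) + (if ∃ a ∈ l.head?, ¬ P a then 1 else 0) ≤
      pathCount r l + (l.filter (¬ P ·)).length := by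
  induction l with
  | nil => simp [pathCount]
  | cons a l ih =>
    cases l with
    | nil => by_cases ha : P a <;> simp [pathCount, ha]
    | cons b l =>
      have h1 := pathCount_le_cons (r := r) a (b :: l)
      by_cases ha : P a <;> by_cases hb : P b
      · simp [ha, hb, pathCount] at ih ⊢
        omega
      · have h2 := pathCount_cons_le (r := r) a (l.filter (P ·))
        simp [ha, hb] at ih h1 h2 ⊢
        omega
      · simp [ha, hb] at ih h1 ⊢
        omega
      · simp [ha, hb] at ih h1 ⊢
        omega

/-- Deleting members splits at most one run each. -/
theorem pathCount_filter_le (l : List V) :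
    pathCount r (l.filter (P ·)) ≤ pathCount r l + (l.filter (¬ P ·)).length :=
  (Nat.le_add_right _ _).trans (pathCount_filter_add P l)

/-- Within a run nothing in `P` follows a member outside `P`, so deletion only cuts off the tail of
each run. If the head is deleted, its whole run disappears, hence the extra term. -/
theorem pathCount_filter_le_of_left (h : ∀ a b, ¬ P a → P b → ¬ r a b) (l : List V) :
    pathCount r (l.filter (P ·)) + (if ∃ a ∈ l.head?, ¬ P a then 1 else 0) ≤ pathCount r l := by
  induction l with
  | nil => simp [pathCount]
  | cons a l ih =>
    cases l with
    | nil => by_cases ha : P a <;> simp [pathCount, ha]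
    | cons b l =>
      have h1 := pathCount_le_cons (r := r) a (b :: l)
      by_cases ha : P a <;> by_cases hb : P b
      · simp [ha, hb, pathCount] at ih ⊢
        omega
      · have h2 := pathCount_cons_le (r := r) a (l.filter (P ·))
        simp [ha, hb] at ih h1 h2 ⊢
        omega
      · have h2 := pathCount_cons_cons_of_not_rel l (h a b ha hb)
        simp [ha, hb] at ih h2 ⊢
        omega
      · simp [ha, hb] at ih h1 ⊢
        omega

/-- Within a run the members outside `P` come first, so deletion only cuts off an initial piece of
each run. -/
theorem pathCount_filter_le_of_right (h : ∀ a b, P a → ¬ P b → ¬ r a b) (l : List V) :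
    pathCount r (l.filter (P ·)) ≤ pathCount r l := by
  induction l with
  | nil => simp [pathCount]
  | cons a l ih =>
    cases l with
    | nil => by_cases ha : P a <;> simp [pathCount, ha]
    | cons b l =>
      have h1 := pathCount_le_cons (r := r) a (b :: l)
      by_cases ha : P a <;> by_cases hb : P b
      · simp [ha, hb, pathCount] at ih ⊢
        omega
      · have h2 := pathCount_cons_le (r := r) a (l.filter (P ·))
        have h3 := pathCount_cons_cons_of_not_rel l (h a b ha hb)
        simp [ha, hb] at ih h3 h2 ⊢
        omega
      · simp [ha, hb] at ih h1 ⊢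
        omega
      · simp [ha, hb] at ih h1 ⊢
        omega

/-- Every run lies entirely inside or entirely outside `P`. -/
theorem pathCount_filter_add_filter_le (h : ∀ a b, r a b → (P a ↔ P b)) (l : List V) :
    pathCount r (l.filter (P ·)) + pathCount r (l.filter (¬ P ·)) ≤ pathCount r l := by
  induction l with
  | nil => simp [pathCount]
  | cons a l ih =>
    cases l with
    | nil => by_cases ha : P a <;> simp [pathCount, ha]
    | cons b l =>
      by_cases ha : P a <;> by_cases hb : P b
      · simp [ha, hb, pathCount] at ih ⊢
        omega
      · have h2 := pathCount_cons_le (r := r) a (l.filter (P ·))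
        have h3 := pathCount_cons_cons_of_not_rel (r := r) l (a := a) (b := b) fun hr => hb ((h a b hr).1 ha)
        simp [ha, hb] at ih h3 h2 ⊢
        omega
      · have h2 := pathCount_cons_le (r := r) a (l.filter (¬ P ·))
        have h3 := pathCount_cons_cons_of_not_rel (r := r) l (a := a) (b := b) fun hr => ha ((h a b hr).2 hb)
        simp [ha, hb] at ih h3 h2 ⊢
        omega
      · simp [ha, hb, pathCount] at ih ⊢
        omega

/-! ### Merging enumerations -/

/-- Join the `i`-th run of `l₁` to the `i`-th run of `l₂`; surplus runs stay as they are. -/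
theorem exists_perm_pathCount_le_max (l₁ l₂ : List V) (h : ∀ a ∈ l₁, ∀ b ∈ l₂, r a b) :
    ∃ l, l.Perm (l₁ ++ l₂) ∧ pathCount r l ≤ max (pathCount r l₁) (pathCount r l₂) := by
  induction hn : l₁.length using Nat.strong_induction_on generalizing l₁ l₂ with
  | _ n ih =>
    by_cases h₁ : l₁ = []
    · exact ⟨l₂, by simp [h₁], le_max_right _ _⟩
    by_cases h₂ : l₂ = []
    · exact ⟨l₁, by simp [h₂], le_max_left _ _⟩
    obtain ⟨p, p', hp, rfl, -, hp1, hp2⟩ := exists_run_append (r := r) h₁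
    obtain ⟨q, q', hq, rfl, -, hq1, hq2⟩ := exists_run_append (r := r) h₂
    have := List.length_pos_iff.2 hp
    obtain ⟨l, hl, hc⟩ := ih p'.length (by rw [← hn, List.length_append]; omega) p' q'
      (fun a ha b hb => h a (by simp [ha]) b (by simp [hb])) rfl
    refine ⟨p ++ q ++ l, ?_, ?_⟩
    · rw [← Multiset.coe_eq_coe] at hl ⊢
      simp only [← Multiset.coe_add] at hl ⊢
      rw [hl]; abel
    · have h3 := pathCount_append_join (r := r) hp hq fun a ha b hb =>
        h a (by simp [List.mem_of_mem_getLast? ha]) b (by simp [List.mem_of_mem_head? hb])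
      have h4 := pathCount_append_le (r := r) (p ++ q) l
      omega

/-- The members of `l₂` serve as connectors between the runs of `l₁`, each saving one run until a
single run remains. The condition on the head lets the recursive result be attached after a
connector. -/
theorem exists_perm_pathCount_le_series (l₁ l₂ : List V) (h₁ : l₁ ≠ []) (h₂ : l₂ ≠ [])
    (h : ∀ a ∈ l₁, ∀ b ∈ l₂, r a b ∧ r b a) (hle : pathCount r l₂ ≤ pathCount r l₁) :
    ∃ l, l.Perm (l₁ ++ l₂) ∧ (∀ a ∈ l.head?, a ∈ l₁) ∧
      pathCount r l ≤ max 1 (pathCount r l₁ - l₂.length) := by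
  induction hn : l₁.length using Nat.strong_induction_on generalizing l₁ l₂ with
  | _ n ih =>
    obtain ⟨p, p', hp, rfl, -, hp1, hp2⟩ := exists_run_append (r := r) h₁
    have hlen := List.length_pos_iff.2 hp
    have hlen₂ := List.length_pos_iff.2 h₂
    have hpos₂ := pathCount_pos (r := r) h₂
    have hhead : ∀ m : List V, ∀ a ∈ (p ++ m).head?, a ∈ p ++ p' := fun m a ha => by
      cases p with
      | nil => exact absurd rfl hp
      | cons x p => simp at ha; simp [ha]
    by_cases hp' : p' = []
    · subst hp'
      refine ⟨p ++ l₂, by simp, hhead _, ?_⟩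
      have h3 := pathCount_append_join (r := r) hp h₂ fun a ha b hb =>
        (h a (by simp [List.mem_of_mem_getLast? ha]) b (by simp [List.mem_of_mem_head? hb])).1
      have : pathCount r ([] : List V) = 0 := by simp [pathCount]
      omega
    have hpos' := pathCount_pos (r := r) hp'
    -- The connector `q` is a single vertex as long as `l₂` has no more runs than `p'`. Otherwise
    -- both lists have equally many runs, and a whole run is spent so that the comparison of run
    -- counts survives the recursion.
    obtain ⟨q, q', hq, rfl, hq1, hq2⟩ : ∃ q q', q ≠ [] ∧ l₂ = q ++ q' ∧ pathCount r q = 1 ∧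
        (q' = [] ∧ l₂.length = 1 ∨ q' ≠ [] ∧ pathCount r q' ≤ pathCount r p' ∧
          pathCount r p' - q'.length ≤ max 1 (pathCount r p' + 1 - l₂.length)) := by
      by_cases heq : pathCount r l₂ ≤ pathCount r p'
      · cases l₂ with
        | nil => exact absurd rfl h₂
        | cons b l₂ =>
          refine ⟨[b], l₂, by simp, by simp, by simp [pathCount], ?_⟩
          by_cases hl : l₂ = []
          · left; simp [hl]
          · right
            refine ⟨hl, (pathCount_le_cons b l₂).trans heq, ?_⟩
            simp only [List.length_cons]
            omega
      · obtain ⟨q, q', hq, rfl, -, hq1, hq2⟩ := exists_run_append (r := r) h₂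
        have hl := pathCount_le_length (r := r) q'
        refine ⟨q, q', hq, rfl, hq1, Or.inr ⟨?_, by omega, by omega⟩⟩
        rintro rfl
        have : pathCount r ([] : List V) = 0 := by simp [pathCount]
        omega
    have hpq := pathCount_append_join (r := r) hp hq fun a ha b hb =>
        (h a (by simp [List.mem_of_mem_getLast? ha]) b (by simp [List.mem_of_mem_head? hb])).1
    obtain ⟨l, hl0, hl, hlh, hlc⟩ : ∃ l : List V, l ≠ [] ∧ l.Perm (p' ++ q') ∧ (∀ a ∈ l.head?, a ∈ p') ∧
        pathCount r l ≤ max 1 (pathCount r (p ++ p') - (q ++ q').length) := by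
      rcases hq2 with ⟨rfl, hq2⟩ | ⟨hq', hc, hlen⟩
      · exact ⟨p', hp', by simp, fun a ha => List.mem_of_mem_head? ha, by omega⟩
      · obtain ⟨l, hl, hlh, hlc⟩ := ih p'.length (by rw [← hn, List.length_append]; omega) p' q' hp' hq'
          (fun a ha b hb => h a (by simp [ha]) b (by simp [hb])) hc rfl
        refine ⟨l, ?_, hl, hlh, by omega⟩
        rintro rfl
        simp at hl
        exact hp' hl.1
    -- `q` ends in `l₂` and `l` starts in `l₁`, so the backward edges join them.
    have hj := pathCount_append_join (r := r) (l := p ++ q) (l' := l) (by simp [hp]) hl0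
      fun a ha b hb => by
        rw [List.getLast?_append_of_ne_nil _ hq] at ha
        exact (h b (by simp [hlh b hb]) a (by simp [List.mem_of_mem_getLast? ha])).2
    refine ⟨p ++ q ++ l, ?_, ?_, ?_⟩
    · rw [← Multiset.coe_eq_coe] at hl ⊢
      simp only [← Multiset.coe_add] at hl ⊢
      rw [hl]; abel
    · rw [List.append_assoc]; exact hhead _
    · omega
end PathCount

/-! ### The recurrence -/

namespace CoExpr

variable {V : Type*} [DecidableEq V]

/-- The path cover number of the subgraph induced by the terminals, and their number. -/
def coverData (T : Finset V) : CoExpr V → ℕ × ℕ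
  | vertex v => if v ∈ T then (1, 1) else (0, 0)
  | union a b => ((a.coverData T).1 + (b.coverData T).1, (a.coverData T).2 + (b.coverData T).2)
  | order a b => (max (a.coverData T).1 (b.coverData T).1, (a.coverData T).2 + (b.coverData T).2)
  | series a b =>
    (max (max ((a.coverData T).1 - (b.coverData T).2) ((b.coverData T).1 - (a.coverData T).2))
      (min 1 ((a.coverData T).2 + (b.coverData T).2)),
     (a.coverData T).2 + (b.coverData T).2)

/-- The list `l` enumerates the terminals in `e`. -/
def Enumerates (T : Finset V) (e : CoExpr V) (l : List V) : Prop :=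
  l.Nodup ∧ ∀ v, v ∈ l ↔ v ∈ e.graph.verts ∧ v ∈ T

/-- The number `p` and the length `n` are attained by an enumeration and `p` is least possible. -/
def IsCoverData (T : Finset V) (e : CoExpr V) (p n : ℕ) : Prop :=
  (∃ l, e.Enumerates T l ∧ pathCount e.graph.Adj l ≤ p) ∧
    ∀ l, e.Enumerates T l → p ≤ pathCount e.graph.Adj l ∧ l.length = n

theorem enumerates_append {T : Finset V} {a b e : CoExpr V}
    (he : e.graph.verts = a.graph.verts ∪ b.graph.verts)
    (hd : Disjoint a.graph.verts b.graph.verts) {l₁ l₂ l : List V} (h₁ : a.Enumerates T l₁)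
    (h₂ : b.Enumerates T l₂) (hl : l.Perm (l₁ ++ l₂)) : e.Enumerates T l := by
  refine ⟨hl.nodup_iff.2 (List.nodup_append.2 ⟨h₁.1, h₂.1, ?_⟩), fun v => ?_⟩
  · rintro x hx y hy rfl
    exact Finset.disjoint_left.1 hd ((h₁.2 x).1 hx).1 ((h₂.2 x).1 hy).1
  · rw [hl.mem_iff, List.mem_append, h₁.2, h₂.2, he, Finset.mem_union]
    tauto

theorem enumerates_filter {T : Finset V} {a b e : CoExpr V}
    (he : e.graph.verts = a.graph.verts ∪ b.graph.verts)
    (hd : Disjoint a.graph.verts b.graph.verts) {l : List V} (h : e.Enumerates T l) :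
    a.Enumerates T (l.filter (· ∈ a.graph.verts)) ∧
      b.Enumerates T (l.filter (¬ · ∈ a.graph.verts)) := by
  refine ⟨⟨h.1.filter _, fun v => ?_⟩, ⟨h.1.filter _, fun v => ?_⟩⟩
  · simp only [List.mem_filter, h.2, he, Finset.mem_union, decide_eq_true_eq]
    tauto
  · have : v ∈ a.graph.verts → v ∉ b.graph.verts := fun h => Finset.disjoint_left.1 hd h
    simp only [List.mem_filter, h.2, he, Finset.mem_union, decide_eq_true_eq]
    tauto

theorem pathCount_filter_graph {T : Finset V} {a b e : CoExpr V}
    (hab : ∀ u v, u ∈ a.graph.verts → v ∈ a.graph.verts → e.graph.Adj u v → a.graph.Adj u v)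
    (hba : ∀ u v, u ∈ b.graph.verts → v ∈ b.graph.verts → e.graph.Adj u v → b.graph.Adj u v)
    {l₁ l₂ : List V} (h₁ : a.Enumerates T l₁) (h₂ : b.Enumerates T l₂) :
    pathCount a.graph.Adj l₁ ≤ pathCount e.graph.Adj l₁ ∧
      pathCount b.graph.Adj l₂ ≤ pathCount e.graph.Adj l₂ :=
  ⟨pathCount_anti fun u hu v hv => hab u v ((h₁.2 u).1 hu).1 ((h₁.2 v).1 hv).1,
    pathCount_anti fun u hu v hv => hba u v ((h₂.2 u).1 hu).1 ((h₂.2 v).1 hv).1⟩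

/-- Each operation needs a merged enumeration for the upper bound and the two restrictions of an
arbitrary enumeration for the lower bound. -/
theorem isCoverData_coverData (T : Finset V) (e : CoExpr V) (he : e.Valid) :
    IsCoverData T e (e.coverData T).1 (e.coverData T).2 := by
  induction e with
  | vertex v =>
    by_cases hv : v ∈ T
    · simp only [coverData, hv, if_true]
      refine ⟨⟨[v], ⟨by simp, fun u => ?_⟩, by simp [pathCount]⟩, fun l hl => ?_⟩
      · simp only [List.mem_singleton, graph, FinDigraph.single, Finset.mem_singleton]
        constructor
        · rintro rfl; exact ⟨rfl, hv⟩
        · exact And.left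
      · have : l = [v] := by
          rw [← List.perm_singleton]
          refine (List.perm_ext_iff_of_nodup hl.1 (by simp)).2 fun u => ?_
          rw [hl.2]
          simp only [List.mem_singleton, graph, FinDigraph.single, Finset.mem_singleton]
          constructor
          · exact And.left
          · rintro rfl; exact ⟨rfl, hv⟩
        simp [this, pathCount]
    · simp only [coverData, hv, if_false]
      refine ⟨⟨[], ⟨by simp, fun u => ?_⟩, by simp [pathCount]⟩, fun l hl => ⟨Nat.zero_le _, ?_⟩⟩
      · simp only [graph, FinDigraph.single, Finset.mem_singleton]
        simp only [List.not_mem_nil, false_iff]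
        rintro ⟨rfl, h⟩; exact hv h
      · rw [List.length_eq_zero_iff, List.eq_nil_iff_forall_not_mem]
        intro u hu
        rw [hl.2] at hu
        simp only [graph, FinDigraph.single, Finset.mem_singleton] at hu
        obtain ⟨rfl, h⟩ := hu
        exact hv h
  | union a b iha ihb =>
    obtain ⟨⟨l₁, e₁, c₁⟩, lb₁⟩ := iha he.1
    obtain ⟨⟨l₂, e₂, c₂⟩, lb₂⟩ := ihb he.2.1
    have hd := Finset.disjoint_left.1 he.2.2
    refine ⟨⟨l₁ ++ l₂, enumerates_append rfl he.2.2 e₁ e₂ (List.Perm.refl _), ?_⟩, fun l hl => ?_⟩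
    · have h1 : pathCount (a.union b).graph.Adj l₁ ≤ _ := pathCount_anti fun u _ v _ h => Or.inl h
      have h2 : pathCount (a.union b).graph.Adj l₂ ≤ _ := pathCount_anti fun u _ v _ h => Or.inr h
      have h3 := pathCount_append_le (r := (a.union b).graph.Adj) l₁ l₂
      simp only [coverData]
      omega
    · obtain ⟨f₁, f₂⟩ := enumerates_filter rfl he.2.2 hl
      have h1 := pathCount_filter_graph (e := a.union b) ?_ ?_ f₁ f₂
      · have h2 := pathCount_filter_add_filter_le (r := (a.union b).graph.Adj) (· ∈ a.graph.verts) ?_ l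
        · have h3 := lb₁ _ f₁
          have h4 := lb₂ _ f₂
          have h5 := List.length_eq_length_filter_add (l := l) (· ∈ a.graph.verts)
          simp only [coverData]
          simp only [decide_not] at *
          omega
        · rintro u v (h | h)
          · exact iff_of_true (a.graph.adj_mem h).1 (a.graph.adj_mem h).2
          · exact iff_of_false (fun h' => hd h' (b.graph.adj_mem h).1)
              (fun h' => hd h' (b.graph.adj_mem h).2)
      · rintro u v hu hv (h | h)
        · exact h
        · exact (hd hu (b.graph.adj_mem h).1).elim
      · rintro u v hu hv (h | h)
        · exact (hd (a.graph.adj_mem h).1 hu).elim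
        · exact h
  | order a b iha ihb =>
    obtain ⟨⟨l₁, e₁, c₁⟩, lb₁⟩ := iha he.1
    obtain ⟨⟨l₂, e₂, c₂⟩, lb₂⟩ := ihb he.2.1
    have hd := Finset.disjoint_left.1 he.2.2
    refine ⟨?_, fun l hl => ?_⟩
    · obtain ⟨l, hl, hc⟩ := exists_perm_pathCount_le_max (r := (a.order b).graph.Adj) l₁ l₂
        fun u hu v hv => Or.inr ⟨((e₁.2 u).1 hu).1, ((e₂.2 v).1 hv).1⟩
      refine ⟨l, enumerates_append rfl he.2.2 e₁ e₂ hl, hc.trans (max_le_max ?_ ?_)⟩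
      · exact (pathCount_anti fun u _ v _ h => Or.inl (Or.inl h)).trans c₁
      · exact (pathCount_anti fun u _ v _ h => Or.inl (Or.inr h)).trans c₂
    · obtain ⟨f₁, f₂⟩ := enumerates_filter rfl he.2.2 hl
      have hn : ∀ u v, ¬ u ∈ a.graph.verts → v ∈ a.graph.verts → ¬ (a.order b).graph.Adj u v := by
        rintro u v hu hv ((h | h) | h)
        · exact hu (a.graph.adj_mem h).1
        · exact hd hv (b.graph.adj_mem h).2
        · exact hu h.1
      have h1 := pathCount_filter_graph (e := a.order b) ?_ ?_ f₁ f₂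
      · have h2 := pathCount_filter_le_of_left (r := (a.order b).graph.Adj) (· ∈ a.graph.verts) hn l
        have h6 := pathCount_filter_le_of_right (r := (a.order b).graph.Adj) (¬ · ∈ a.graph.verts)
          (fun u v hu hv => hn u v hu (not_not.1 hv)) l
        have h3 := lb₁ _ f₁
        have h4 := lb₂ _ f₂
        have h5 := List.length_eq_length_filter_add (l := l) (· ∈ a.graph.verts)
        simp only [coverData]
        simp only [decide_not] at *
        omega
      · rintro u v hu hv ((h | h) | h)
        · exact h
        · exact (hd hu (b.graph.adj_mem h).1).elim
        · exact (hd hv h.2).elim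
      · rintro u v hu hv ((h | h) | h)
        · exact (hd (a.graph.adj_mem h).1 hu).elim
        · exact h
        · exact (hd h.1 hu).elim
  | series a b iha ihb =>
    obtain ⟨⟨l₁, e₁, c₁⟩, lb₁⟩ := iha he.1
    obtain ⟨⟨l₂, e₂, c₂⟩, lb₂⟩ := ihb he.2.1
    have hd := Finset.disjoint_left.1 he.2.2
    refine ⟨?_, fun l hl => ?_⟩
    · have d₁ : pathCount (a.series b).graph.Adj l₁ ≤ _ :=
        (pathCount_anti fun u _ v _ h => Or.inl (Or.inl h)).trans c₁
      have d₂ : pathCount (a.series b).graph.Adj l₂ ≤ _ :=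
        (pathCount_anti fun u _ v _ h => Or.inl (Or.inr h)).trans c₂
      have n₁ := (lb₁ _ e₁).2
      have n₂ := (lb₂ _ e₂).2
      have hadj : ∀ u ∈ l₁, ∀ v ∈ l₂, (a.series b).graph.Adj u v ∧ (a.series b).graph.Adj v u :=
        fun u hu v hv => ⟨Or.inr (Or.inl ⟨((e₁.2 u).1 hu).1, ((e₂.2 v).1 hv).1⟩),
          Or.inr (Or.inr ⟨((e₂.2 v).1 hv).1, ((e₁.2 u).1 hu).1⟩)⟩
      obtain ⟨l, hl, hc⟩ : ∃ l, l.Perm (l₁ ++ l₂) ∧ pathCount (a.series b).graph.Adj l ≤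
          max (max (pathCount (a.series b).graph.Adj l₁ - l₂.length)
            (pathCount (a.series b).graph.Adj l₂ - l₁.length)) (min 1 (l₁.length + l₂.length)) := by
        -- A part without terminals offers no connectors; the other enumeration is then already
        -- optimal.
        by_cases h₁ : l₁ = []
        · exact ⟨l₂, by simp [h₁], by simp [h₁]⟩
        by_cases h₂ : l₂ = []
        · exact ⟨l₁, by simp [h₂], by simp [h₂]⟩
        have := List.length_pos_iff.2 h₁
        rcases le_total (pathCount (a.series b).graph.Adj l₂) (pathCount (a.series b).graph.Adj l₁)
          with hle | hle
        · obtain ⟨l, hl, -, hc⟩ := exists_perm_pathCount_le_series l₁ l₂ h₁ h₂ hadj hle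
          exact ⟨l, hl, by omega⟩
        · obtain ⟨l, hl, -, hc⟩ := exists_perm_pathCount_le_series l₂ l₁ h₂ h₁
            (fun u hu v hv => (hadj v hv u hu).symm) hle
          exact ⟨l, hl.trans List.perm_append_comm, by omega⟩
      refine ⟨l, enumerates_append rfl he.2.2 e₁ e₂ hl, ?_⟩
      simp only [coverData]
      omega
    · obtain ⟨f₁, f₂⟩ := enumerates_filter rfl he.2.2 hl
      have h1 := pathCount_filter_graph (e := a.series b) ?_ ?_ f₁ f₂
      · have h2 := pathCount_filter_le (r := (a.series b).graph.Adj) (· ∈ a.graph.verts) l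
        have h6 := pathCount_filter_le (r := (a.series b).graph.Adj) (¬ · ∈ a.graph.verts) l
        have h3 := lb₁ _ f₁
        have h4 := lb₂ _ f₂
        have h5 := List.length_eq_length_filter_add (l := l) (· ∈ a.graph.verts)
        have h7 : l.length ≠ 0 → 1 ≤ pathCount (a.series b).graph.Adj l :=
          fun h => pathCount_pos fun h' => h (by simp [h'])
        simp only [coverData]
        simp only [decide_not, Bool.not_not] at *
        omega
      · rintro u v hu hv ((h | h) | h | h)
        · exact h
        · exact (hd hu (b.graph.adj_mem h).1).elim
        · exact (hd hv h.2).elim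
        · exact (hd hu h.1).elim
      · rintro u v hu hv ((h | h) | h | h)
        · exact (hd (a.graph.adj_mem h).1 hu).elim
        · exact h
        · exact (hd h.1 hu).elim
        · exact (hd h.2 hv).elim

/-- These bounds keep all values that the machine computes within its words. -/
theorem coverData_le (T : Finset V) (e : CoExpr V) :
    (e.coverData T).1 ≤ (e.coverData T).2 ∧ (e.coverData T).2 ≤ e.size := by
  induction e with
  | vertex v => simp only [coverData, size]; split_ifs <;> simp
  | union a b iha ihb | order a b iha ihb | series a b iha ihb => simp only [coverData, size]; omega

/-- Steiner vertices do not pay: the least cost is the path cover number of the subgraph induced by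
the terminals. -/
theorem isLeast_coverData (T : Finset V) (e : CoExpr V) (he : e.Valid) (hT : T ⊆ e.graph.verts) :
    IsLeast {k | ∃ C : Finset (List V), e.graph.IsSteinerPathCover T C ∧
      k = C.card + FinDigraph.steinerCount T C} (e.coverData T).1 := by
  obtain ⟨⟨l, hl, hc⟩, lb⟩ := isCoverData_coverData T e he
  have key : ∀ k ∈ {k | ∃ C : Finset (List V), e.graph.IsSteinerPathCover T C ∧
      k = C.card + FinDigraph.steinerCount T C}, (e.coverData T).1 ≤ k := by
    rintro k ⟨C, ⟨hp, hdisj, hcov⟩, rfl⟩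
    have hw : C.toList.flatten.Nodup := by
      rw [List.nodup_flatten]
      refine ⟨fun p h => (hp p (by simpa using h)).2.1, ?_⟩
      refine (List.Nodup.pairwise_of_forall_ne C.nodup_toList ?_)
      intro p h q h' hne
      exact fun v hv hv' => hdisj p (by simpa using h) q (by simpa using h') hne v hv hv'
    have h1 := pathCount_flatten_le (r := e.graph.Adj) C.toList
      fun p h => (hp p (by simpa using h)).2.2.2
    -- The deleted members are exactly the Steiner vertices, so their number is what the cost
    -- already charges.
    have h2 := pathCount_filter_le (r := e.graph.Adj) (· ∈ T) C.toList.flatten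
    have h3 := lb (C.toList.flatten.filter (· ∈ T)) ⟨hw.filter _, fun v => by
      simp only [List.mem_filter, decide_eq_true_eq, List.mem_flatten, Finset.mem_toList]
      constructor
      · rintro ⟨⟨p, h, hv⟩, ht⟩; exact ⟨(hp p h).2.2.1 v hv, ht⟩
      · rintro ⟨-, ht⟩; exact ⟨hcov v ht, ht⟩⟩
    have h4 : FinDigraph.steinerCount T C = (C.toList.flatten.filter (¬ · ∈ T)).length := by
      rw [FinDigraph.steinerCount, ← List.toFinset_card_of_nodup (hw.filter _)]
      congr 1
      ext v
      simp [← and_assoc, exists_and_right]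
    rw [h4]
    rw [Finset.length_toList] at h1
    omega
  refine ⟨?_, key⟩
  obtain ⟨L, hL, hLc, hLp⟩ := exists_runs (r := e.graph.Adj) l
  have hnd := hl.1
  rw [← hL, List.nodup_flatten] at hnd
  have hmem : ∀ p ∈ L, ∀ v ∈ p, v ∈ l := fun p h v hv => by
    rw [← hL]; exact List.mem_flatten.2 ⟨p, h, hv⟩
  have hcover : e.graph.IsSteinerPathCover T L.toFinset := by
    refine ⟨fun p h => ?_, fun p h q h' hne v hv hv' => ?_, fun t ht => ?_⟩
    · rw [List.mem_toFinset] at h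
      exact ⟨(hLp p h).1, hnd.1 p h, fun v hv => ((hl.2 v).1 (hmem p h v hv)).1, (hLp p h).2⟩
    · rw [List.mem_toFinset] at h h'
      have : Std.Symm (List.Disjoint (α := V)) := ⟨fun _ _ h => h.symm⟩
      exact hnd.2.forall h h' hne hv hv'
    · have : t ∈ L.flatten := by rw [hL, hl.2]; exact ⟨hT ht, ht⟩
      simpa using this
  have hs : FinDigraph.steinerCount T L.toFinset = 0 := by
    rw [FinDigraph.steinerCount, Finset.card_eq_zero, Finset.sdiff_eq_empty_iff_subset]
    intro v hv
    simp only [Finset.mem_biUnion, List.mem_toFinset] at hv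
    obtain ⟨p, h, hv⟩ := hv
    exact ((hl.2 v).1 (hmem p h v hv)).2
  refine ⟨_, hcover, le_antisymm (key _ ⟨_, hcover, rfl⟩) ?_⟩
  -- An upper bound on the number of paths suffices, as `key` supplies the other inequality.
  have := L.toFinset_card_le
  omega

end CoExpr

/-! ### Reasoning about programs -/

namespace RAM

variable {W : ℕ} {P : List Instr} {Q : Config → Prop}

/-- Within at most `k` steps the program reaches, without overflow, a configuration with `Q`. -/
def Reaches (W : ℕ) (P : List Instr) (Q : Config → Prop) (k : ℕ) (s : Config) : Prop :=
  ∃ j ≤ k, ∃ s', run W P j s = some s' ∧ Q s'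

/-- The registers that hold the given list, followed by zeros. -/
def regs (L : List ℕ) (i : ℕ) : ℕ := L.getD i 0

theorem update_regs (L : List ℕ) {i : ℕ} (hi : i < L.length) (n : ℕ) :
    Function.update (regs L) i n = regs (L.set i n) := by
  funext j
  by_cases h : j = i
  · subst h
    simp [regs, List.getD_eq_getElem?_getD, hi]
  · simp [regs, List.getD_eq_getElem?_getD, h, List.getElem?_set_ne (Ne.symm h)]

theorem Reaches.of_holds {s : Config} (h : Q s) (k : ℕ) : Reaches W P Q k s :=
  ⟨0, Nat.zero_le _, s, rfl, h⟩

theorem Reaches.mono {s : Config} {k k' : ℕ} (h : Reaches W P Q k s) (hk : k ≤ k') :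
    Reaches W P Q k' s :=
  let ⟨j, hj, h⟩ := h
  ⟨j, hj.trans hk, h⟩

theorem Reaches.of_step {s s' : Config} {k : ℕ} (h : step W P s = some s')
    (H : Reaches W P Q k s') : Reaches W P Q (k + 1) s :=
  let ⟨j, hj, s'', h1, h2⟩ := H
  ⟨j + 1, Nat.succ_le_succ hj, s'', by simp [run, h, h1], h2⟩

variable {pc k : ℕ} {L : List ℕ} {mem : ℕ → ℕ}

theorem reaches_const {i n : ℕ} (h : P[pc]? = some (.const i n)) (hi : i < L.length) (hn : n ≤ W)
    (H : Reaches W P Q k ⟨pc + 1, regs (L.set i n), mem⟩) :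
    Reaches W P Q (k + 1) ⟨pc, regs L, mem⟩ :=
  H.of_step (by simp [step, h, Config.write, hn, update_regs L hi])

theorem reaches_copy {i j : ℕ} (h : P[pc]? = some (.copy i j)) (hi : i < L.length)
    (hn : L.getD j 0 ≤ W)
    (H : Reaches W P Q k ⟨pc + 1, regs (L.set i (L.getD j 0)), mem⟩) :
    Reaches W P Q (k + 1) ⟨pc, regs L, mem⟩ :=
  H.of_step (by
    rw [← update_regs L hi]
    simp only [step, h, Config.write]
    exact if_pos hn)

theorem reaches_add {i j l : ℕ} (h : P[pc]? = some (.add i j l)) (hi : i < L.length)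
    (hn : L.getD j 0 + L.getD l 0 ≤ W)
    (H : Reaches W P Q k ⟨pc + 1, regs (L.set i (L.getD j 0 + L.getD l 0)), mem⟩) :
    Reaches W P Q (k + 1) ⟨pc, regs L, mem⟩ :=
  H.of_step (by
    rw [← update_regs L hi]
    simp only [step, h, Config.write]
    exact if_pos hn)

theorem reaches_sub {i j l : ℕ} (h : P[pc]? = some (.sub i j l)) (hi : i < L.length)
    (hn : L.getD j 0 - L.getD l 0 ≤ W)
    (H : Reaches W P Q k ⟨pc + 1, regs (L.set i (L.getD j 0 - L.getD l 0)), mem⟩) :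
    Reaches W P Q (k + 1) ⟨pc, regs L, mem⟩ :=
  H.of_step (by
    rw [← update_regs L hi]
    simp only [step, h, Config.write]
    exact if_pos hn)

/-- Address and value are arguments, so that the new register list shows a known number in place of
a memory lookup. -/
theorem reaches_load {i j : ℕ} (a v : ℕ) (h : P[pc]? = some (.load i j)) (hi : i < L.length)
    (ha : L.getD j 0 = a) (hv : mem a = v) (hn : v ≤ W)
    (H : Reaches W P Q k ⟨pc + 1, regs (L.set i v), mem⟩) :
    Reaches W P Q (k + 1) ⟨pc, regs L, mem⟩ :=
  H.of_step (by
    subst ha hv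
    rw [← update_regs L hi]
    simp only [step, h, Config.write]
    exact if_pos hn)

theorem reaches_store {i j : ℕ} (h : P[pc]? = some (.store i j))
    (H : Reaches W P Q k ⟨pc + 1, regs L, Function.update mem (L.getD i 0) (L.getD j 0)⟩) :
    Reaches W P Q (k + 1) ⟨pc, regs L, mem⟩ :=
  H.of_step (by simp only [step, h]; rfl)

theorem reaches_jump {l : ℕ} (h : P[pc]? = some (.jump l))
    (H : Reaches W P Q k ⟨l, regs L, mem⟩) : Reaches W P Q (k + 1) ⟨pc, regs L, mem⟩ :=
  H.of_step (by simp only [step, h])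

theorem reaches_jumpZero_zero {i l : ℕ} (h : P[pc]? = some (.jumpZero i l)) (h0 : L.getD i 0 = 0)
    (H : Reaches W P Q k ⟨l, regs L, mem⟩) : Reaches W P Q (k + 1) ⟨pc, regs L, mem⟩ :=
  H.of_step (by simp only [step, h]; rw [if_pos (show regs L i = 0 from h0)])

theorem reaches_jumpZero_pos {i l : ℕ} (h : P[pc]? = some (.jumpZero i l)) (h0 : L.getD i 0 ≠ 0)
    (H : Reaches W P Q k ⟨pc + 1, regs L, mem⟩) : Reaches W P Q (k + 1) ⟨pc, regs L, mem⟩ :=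
  H.of_step (by simp only [step, h]; rw [if_neg (show ¬ regs L i = 0 from h0)])

/-- The memory holds the list from the given address on. -/
def Reads (mem : ℕ → ℕ) : ℕ → List ℕ → Prop
  | _, [] => True
  | a, x :: l => mem a = x ∧ Reads mem (a + 1) l

theorem reads_append {a : ℕ} {l l' : List ℕ} :
    Reads mem a (l ++ l') ↔ Reads mem a l ∧ Reads mem (a + l.length) l' := by
  induction l generalizing a with
  | nil => simp [Reads]
  | cons x l ih =>
    simp only [List.cons_append, Reads, ih, List.length_cons, and_assoc]
    rw [show a + 1 + l.length = a + (l.length + 1) by omega]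

theorem Reads.congr {mem' : ℕ → ℕ} {a : ℕ} {l : List ℕ} (h : Reads mem a l)
    (hm : ∀ x, x < a + l.length → mem' x = mem x) : Reads mem' a l := by
  induction l generalizing a with
  | nil => trivial
  | cons x l ih =>
    simp only [List.length_cons] at hm
    exact ⟨(hm a (by omega)).trans h.1, ih h.2 fun y hy => hm y (by omega)⟩

theorem reads_getD (l l' : List ℕ) : Reads (fun a => (l' ++ l).getD a 0) l'.length l := by
  induction l generalizing l' with
  | nil => trivial
  | cons x l ih =>
    refine ⟨by simp, ?_⟩
    have := ih (l' ++ [x])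
    simpa using this

/-! ### The program -/

/-- Registers: `0` length of the input, `1` next input cell, `2` top of the stack, `3` start of the
table that marks the terminals, `4` the number one, the others scratch. An evaluated subexpression
takes two cells of the stack, a pending operation takes one. -/
def steinerProgram : List Instr :=
  [.const 4 1, .copy 2 0, .add 3 0 0, .add 3 3 0, .load 5 1, .copy 1 4,
   -- 6: mark the terminals
   .jumpZero 5 14, .load 6 1, .add 6 6 3, .add 6 6 4, .store 6 4, .add 1 1 4, .sub 5 5 4, .jump 6,
   -- 14: read the next symbol
   .sub 6 0 1, .jumpZero 6 63, .load 5 1, .add 1 1 4, .jumpZero 5 14, .sub 6 5 4, .jumpZero 6 34,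
   .const 7 4, .sub 6 5 7, .jumpZero 6 31,
   -- 24: a vertex
   .add 6 6 3, .load 6 6, .store 2 6, .add 2 2 4, .store 2 6, .add 2 2 4, .jump 14,
   -- 31: an operation
   .store 2 5, .add 2 2 4, .jump 14,
   -- 34: a closing parenthesis
   .sub 2 2 4, .load 5 2, .sub 2 2 4, .load 6 2, .sub 2 2 4, .load 7 2, .sub 2 2 4, .load 8 2,
   .sub 2 2 4, .load 9 2, .add 10 8 5, .const 11 2, .sub 7 7 11, .jumpZero 7 57, .sub 7 7 4,
   .jumpZero 7 56,
   -- 50: series composition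
   .sub 9 9 5, .sub 6 6 8, .sub 6 6 9, .add 9 9 6, .sub 11 10 4, .sub 6 10 11,
   -- 56: the maximum, 57: the sum
   .sub 6 6 9, .add 9 9 6, .store 2 9, .add 2 2 4, .store 2 10, .add 2 2 4, .jump 14,
   -- 63: the end
   .load 0 0, .halt]

/-- The number of paths for a composition, from the numbers of paths and of terminals of the parts. -/
def combine (op : ℕ) (d d' : ℕ × ℕ) : ℕ :=
  if op = 2 then d.1 + d'.1 else if op = 3 then max d.1 d'.1
  else max (max (d.1 - d'.2) (d'.1 - d.2)) (min 1 (d.2 + d'.2))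

/-! ### Execution of the program fragments: a bound from the exit yields one from the entry -/

variable {len ip sp tb x5 x6 x7 x8 x9 x10 x11 : ℕ}

/-- Each terminal costs one round of 8 instructions. The marks lie above `tb`, hence beyond the
terminals still to be read. -/
theorem reaches_mark (l : List ℕ) (hl : Reads mem ip l) (h5 : x5 = l.length)
    (hip : ip + l.length ≤ tb) (_ : tb + 5 ≤ W) (hlW : ∀ t ∈ l, tb + t + 5 ≤ W)
    (H : ∀ x5 x6 mem', (∀ a, mem' a = if ∃ t ∈ l, a = tb + t + 1 then 1 else mem a) →
      Reaches W steinerProgram Q k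
        ⟨14, regs [len, ip + l.length, sp, tb, 1, x5, x6, x7, x8, x9, x10, x11], mem'⟩) :
    Reaches W steinerProgram Q (k + 1 + 8 * l.length)
      ⟨6, regs [len, ip, sp, tb, 1, x5, x6, x7, x8, x9, x10, x11], mem⟩ := by
  induction l generalizing ip x5 x6 mem with
  | nil =>
    subst h5
    exact reaches_jumpZero_zero rfl rfl (H _ _ _ (by simp))
  | cons t l ih =>
    have h1 := hlW t (by simp)
    simp only [List.length_cons] at *
    refine reaches_jumpZero_pos rfl (by simp; omega) ?_
    refine reaches_load ip t rfl (by simp) rfl hl.1 (by omega) ?_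
    refine reaches_add rfl (by simp) (by simp; omega) ?_
    refine reaches_add rfl (by simp) (by simp; omega) ?_
    refine reaches_store rfl ?_
    refine reaches_add rfl (by simp) (by simp; omega) ?_
    refine reaches_sub rfl (by simp) (by simp; omega) ?_
    refine reaches_jump rfl ?_
    refine (ih (ip := ip + 1) (x5 := x5 - 1) (hl.2.congr fun x hx => ?_) (by omega) (by omega)
      (fun u hu => hlW u (by simp [hu])) fun x5' x6' mem' hm => ?_).mono (le_refl _)
    · exact Function.update_of_ne (by simp; omega) _ _
    · rw [show ip + 1 + l.length = ip + (l.length + 1) by omega]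
      refine H x5' x6' mem' fun a => ?_
      rw [hm]
      by_cases h : a = tb + t + 1
      · simp [h, add_comm]
      · have : (∃ u ∈ t :: l, a = tb + u + 1) ↔ ∃ u ∈ l, a = tb + u + 1 := by simp [h]
        simp only [this]
        congr 1
        exact Function.update_of_ne (by simp; omega) _ _

theorem reaches_open (hl : mem ip = 0) (hip : ip < len) (hW : len ≤ W)
    (H : ∀ x6, Reaches W steinerProgram Q k
        ⟨14, regs [len, ip + 1, sp, tb, 1, 0, x6, x7, x8, x9, x10, x11], mem⟩) :
    Reaches W steinerProgram Q (k + 5)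
      ⟨14, regs [len, ip, sp, tb, 1, x5, x6, x7, x8, x9, x10, x11], mem⟩ := by
  refine reaches_sub rfl (by simp) (by simp; omega) ?_
  refine reaches_jumpZero_pos rfl (by simp; omega) ?_
  refine reaches_load ip 0 rfl (by simp) rfl hl (by omega) ?_
  refine reaches_add rfl (by simp) (by simp; omega) ?_
  refine reaches_jumpZero_zero rfl (by simp) ?_
  exact H _

theorem reaches_operation {op : ℕ} (hl : mem ip = op) (h2 : 2 ≤ op) (h4 : op ≤ 4) (hip : ip < len)
    (hW : len + 4 ≤ W) (hsp : sp + 1 ≤ W)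
    (H : ∀ x6 x7, Reaches W steinerProgram Q k
        ⟨14, regs [len, ip + 1, sp + 1, tb, 1, op, x6, x7, x8, x9, x10, x11],
          Function.update mem sp op⟩) :
    Reaches W steinerProgram Q (k + 13)
      ⟨14, regs [len, ip, sp, tb, 1, x5, x6, x7, x8, x9, x10, x11], mem⟩ := by
  refine reaches_sub rfl (by simp) (by simp; omega) ?_
  refine reaches_jumpZero_pos rfl (by simp; omega) ?_
  refine reaches_load ip op rfl (by simp) rfl hl (by omega) ?_
  refine reaches_add rfl (by simp) (by simp; omega) ?_
  refine reaches_jumpZero_pos rfl (by simp; omega) ?_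
  refine reaches_sub rfl (by simp) (by simp; omega) ?_
  refine reaches_jumpZero_pos rfl (by simp; omega) ?_
  refine reaches_const rfl (by simp) (by omega) ?_
  refine reaches_sub rfl (by simp) (by simp; omega) ?_
  refine reaches_jumpZero_zero rfl (by simp; omega) ?_
  refine reaches_store rfl ?_
  refine reaches_add rfl (by simp) (by simp; omega) ?_
  refine reaches_jump rfl ?_
  exact H _ _

/-- The symbol `v + 5` minus 4, left over from the test for operations, is the offset `v + 1` of the
table entry. Its mark is pushed twice, being both the path number and the terminal number of a
single vertex. -/
theorem reaches_vertex {v b : ℕ} (hl : mem ip = v + 5) (hb : mem (tb + v + 1) = b) (hip : ip < len)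
    (hW : len + 5 ≤ W) (hvW : tb + v + 5 ≤ W) (hsp : sp + 2 ≤ tb) (hbW : b ≤ W)
    (H : ∀ x5 x6 x7, Reaches W steinerProgram Q k
        ⟨14, regs [len, ip + 1, sp + 2, tb, 1, x5, x6, x7, x8, x9, x10, x11],
          Function.update (Function.update mem sp b) (sp + 1) b⟩) :
    Reaches W steinerProgram Q (k + 17)
      ⟨14, regs [len, ip, sp, tb, 1, x5, x6, x7, x8, x9, x10, x11], mem⟩ := by
  refine reaches_sub rfl (by simp) (by simp; omega) ?_
  refine reaches_jumpZero_pos rfl (by simp; omega) ?_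
  refine reaches_load ip (v + 5) rfl (by simp) rfl hl (by omega) ?_
  refine reaches_add rfl (by simp) (by simp; omega) ?_
  refine reaches_jumpZero_pos rfl (by simp) ?_
  refine reaches_sub rfl (by simp) (by simp; omega) ?_
  refine reaches_jumpZero_pos rfl (by simp) ?_
  refine reaches_const rfl (by simp) (by omega) ?_
  refine reaches_sub rfl (by simp) (by simp; omega) ?_
  refine reaches_jumpZero_pos rfl (by simp) ?_
  refine reaches_add rfl (by simp) (by simp; omega) ?_
  refine reaches_load (tb + v + 1) b rfl (by simp) (by simp; omega) hb hbW ?_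
  refine reaches_store rfl ?_
  refine reaches_add rfl (by simp) (by simp; omega) ?_
  refine reaches_store rfl ?_
  refine reaches_add rfl (by simp) (by simp; omega) ?_
  refine reaches_jump rfl ?_
  exact H _ _ _

theorem reaches_combine_sum {x : ℕ} (hx : x9 + x6 = x) (hxW : x ≤ W) (hsp : sp + 2 ≤ W)
    (H : ∀ x9, Reaches W steinerProgram Q k
        ⟨14, regs [len, ip, sp + 2, tb, 1, x5, x6, x7, x8, x9, x10, x11],
          Function.update (Function.update mem sp x) (sp + 1) x10⟩) :
    Reaches W steinerProgram Q (k + 6)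
      ⟨57, regs [len, ip, sp, tb, 1, x5, x6, x7, x8, x9, x10, x11], mem⟩ := by
  subst hx
  refine reaches_add rfl (by simp) (by simpa using hxW) ?_
  refine reaches_store rfl ?_
  refine reaches_add rfl (by simp) (by simp; omega) ?_
  refine reaches_store rfl ?_
  refine reaches_add rfl (by simp) (by simp; omega) ?_
  refine reaches_jump rfl ?_
  exact H _

theorem reaches_combine_max {x : ℕ} (hx : max x9 x6 = x) (hxW : x ≤ W) (hsp : sp + 2 ≤ W)
    (H : ∀ x6 x9, Reaches W steinerProgram Q k
        ⟨14, regs [len, ip, sp + 2, tb, 1, x5, x6, x7, x8, x9, x10, x11],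
          Function.update (Function.update mem sp x) (sp + 1) x10⟩) :
    Reaches W steinerProgram Q (k + 7)
      ⟨56, regs [len, ip, sp, tb, 1, x5, x6, x7, x8, x9, x10, x11], mem⟩ := by
  refine reaches_sub rfl (by simp) (by simp; omega) ?_
  exact reaches_combine_sum (by simp; omega) hxW hsp (H _)

theorem reaches_combine_series {a b n n' : ℕ} (hsp : sp + 2 ≤ W) (ha : a ≤ n) (hb : b ≤ n')
    (hdW : n + n' ≤ W)
    (H : ∀ x6 x9 x11, Reaches W steinerProgram Q k
        ⟨14, regs [len, ip, sp + 2, tb, 1, n', x6, x7, n, x9, n + n', x11],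
          Function.update (Function.update mem sp
            (max (max (a - n') (b - n)) (min 1 (n + n')))) (sp + 1) (n + n')⟩) :
    Reaches W steinerProgram Q (k + 13)
      ⟨50, regs [len, ip, sp, tb, 1, n', b, x7, n, a, n + n', x11], mem⟩ := by
  refine reaches_sub rfl (by simp) (by simp; omega) ?_
  refine reaches_sub rfl (by simp) (by simp; omega) ?_
  refine reaches_sub rfl (by simp) (by simp; omega) ?_
  refine reaches_add rfl (by simp) (by simp; omega) ?_
  refine reaches_sub rfl (by simp) (by simp; omega) ?_
  refine reaches_sub rfl (by simp) (by simp; omega) ?_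
  exact reaches_combine_max (by simp; omega) (by omega) hsp fun x6 x9 => H x6 x9 _

theorem reaches_combine {op : ℕ} {d d' : ℕ × ℕ} (h2 : 2 ≤ op) (h4 : op ≤ 4) (hW : 4 ≤ W)
    (hsp : sp + 2 ≤ W) (hd : d.1 ≤ d.2) (hd' : d'.1 ≤ d'.2) (hdW : d.2 + d'.2 ≤ W)
    (H : ∀ x6 x7 x9 x11, Reaches W steinerProgram Q k
        ⟨14, regs [len, ip, sp + 2, tb, 1, d'.2, x6, x7, d.2, x9, d.2 + d'.2, x11],
          Function.update (Function.update mem sp (combine op d d')) (sp + 1) (d.2 + d'.2)⟩) :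
    Reaches W steinerProgram Q (k + 18)
      ⟨45, regs [len, ip, sp, tb, 1, d'.2, d'.1, op, d.2, d.1, d.2 + d'.2, x11], mem⟩ := by
  refine reaches_const rfl (by simp) (by omega) ?_
  refine reaches_sub rfl (by simp) (by simp; omega) ?_
  by_cases ho2 : op = 2
  · refine reaches_jumpZero_zero rfl (by simp; omega) ?_
    -- The slack pads this branch to the 18 steps of the longest one, series composition.
    refine (reaches_combine_sum (k := k) rfl (by omega) hsp fun x9 => ?_).mono
      (Nat.le_add_right _ 9)
    simpa [combine, ho2] using H d'.1 (op - 2) x9 2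
  refine reaches_jumpZero_pos rfl (by simp; omega) ?_
  refine reaches_sub rfl (by simp) (by simp; omega) ?_
  by_cases ho3 : op = 3
  · refine reaches_jumpZero_zero rfl (by simp; omega) ?_
    refine (reaches_combine_max (k := k) rfl (by omega) hsp fun x6 x9 => ?_).mono
      (Nat.le_add_right _ 6)
    simpa [combine, ho3] using H x6 (op - 2 - 1) x9 2
  refine reaches_jumpZero_pos rfl (by simp; omega) ?_
  refine reaches_combine_series hsp hd hd' hdW fun x6 x9 x11 => ?_
  simpa [combine, ho2, ho3] using H x6 (op - 2 - 1) x9 x11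

theorem reaches_close {op : ℕ} {d d' : ℕ × ℕ} (hl : mem ip = 1) (h2 : 2 ≤ op) (h4 : op ≤ 4)
    (hip : ip < len) (hW : len + 4 ≤ W) (hsp : sp + 5 ≤ W)
    (m0 : mem sp = d.1) (m1 : mem (sp + 1) = d.2) (m2 : mem (sp + 2) = op)
    (m3 : mem (sp + 3) = d'.1) (m4 : mem (sp + 4) = d'.2)
    (hd : d.1 ≤ d.2) (hd' : d'.1 ≤ d'.2) (hdW : d.2 + d'.2 ≤ W)
    (H : ∀ x5 x6 x7 x8 x9 x10 x11, Reaches W steinerProgram Q k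
        ⟨14, regs [len, ip + 1, sp + 2, tb, 1, x5, x6, x7, x8, x9, x10, x11],
          Function.update (Function.update mem sp (combine op d d')) (sp + 1) (d.2 + d'.2)⟩) :
    Reaches W steinerProgram Q (k + 36)
      ⟨14, regs [len, ip, sp + 5, tb, 1, x5, x6, x7, x8, x9, x10, x11], mem⟩ := by
  refine reaches_sub rfl (by simp) (by simp; omega) ?_
  refine reaches_jumpZero_pos rfl (by simp; omega) ?_
  refine reaches_load ip 1 rfl (by simp) rfl hl (by omega) ?_
  refine reaches_add rfl (by simp) (by simp; omega) ?_
  refine reaches_jumpZero_pos rfl (by simp) ?_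
  refine reaches_sub rfl (by simp) (by simp) ?_
  refine reaches_jumpZero_zero rfl (by simp) ?_
  refine reaches_sub rfl (by simp) (by simp; omega) ?_
  refine reaches_load (sp + 4) d'.2 rfl (by simp) (by simp) m4 (by omega) ?_
  simp only [List.set_cons_zero, List.set_cons_succ, List.getD_cons_zero, List.getD_cons_succ,
    Nat.reduceAdd, Nat.add_one_sub_one]
  refine reaches_sub rfl (by simp) (by simp; omega) ?_
  refine reaches_load (sp + 3) d'.1 rfl (by simp) (by simp) m3 (by omega) ?_
  simp only [List.set_cons_zero, List.set_cons_succ, List.getD_cons_zero, List.getD_cons_succ,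
    Nat.reduceAdd, Nat.add_one_sub_one]
  refine reaches_sub rfl (by simp) (by simp; omega) ?_
  refine reaches_load (sp + 2) op rfl (by simp) (by simp) m2 (by omega) ?_
  simp only [List.set_cons_zero, List.set_cons_succ, List.getD_cons_zero, List.getD_cons_succ,
    Nat.reduceAdd, Nat.add_one_sub_one]
  refine reaches_sub rfl (by simp) (by simp; omega) ?_
  refine reaches_load (sp + 1) d.2 rfl (by simp) (by simp) m1 (by omega) ?_
  simp only [List.set_cons_zero, List.set_cons_succ, List.getD_cons_zero, List.getD_cons_succ,
    Nat.reduceAdd, Nat.add_one_sub_one]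
  refine reaches_sub rfl (by simp) (by simp; omega) ?_
  refine reaches_load sp d.1 rfl (by simp) (by simp) m0 (by omega) ?_
  refine reaches_add rfl (by simp) (by simp; omega) ?_
  show Reaches W steinerProgram Q _
    ⟨45, regs [len, ip + 1, sp, tb, 1, d'.2, d'.1, op, d.2, d.1, d.2 + d'.2, x11], mem⟩
  exact reaches_combine h2 h4 (by omega) (by omega) hd hd' hdW fun x6 x7 x9 x11 =>
    H _ _ _ _ _ _ _

/-! ### Evaluation of an expression by induction -/

/-- The program evaluates the input segment `enc` to `d`, for the terminals in `T`. -/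
def Evaluates (W : ℕ) (T : Finset ℕ) (enc : List ℕ) (d : ℕ × ℕ) : Prop :=
  ∀ (len ip sp tb x5 x6 x7 x8 x9 x10 x11 : ℕ) (mem : ℕ → ℕ) (k : ℕ) (Q : Config → Prop),
    Reads mem ip enc → ip + enc.length ≤ len → len ≤ sp → sp + 2 * enc.length ≤ tb →
    tb + 5 ≤ W → (∀ x ∈ enc, tb + x ≤ W) → (∀ v, mem (tb + v + 1) = if v ∈ T then 1 else 0) →
    (∀ (x5 x6 x7 x8 x9 x10 x11 : ℕ) (mem' : ℕ → ℕ), (∀ a, a < sp ∨ tb ≤ a → mem' a = mem a) →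
      mem' sp = d.1 → mem' (sp + 1) = d.2 → Reaches W steinerProgram Q k
        ⟨14, regs [len, ip + enc.length, sp + 2, tb, 1, x5, x6, x7, x8, x9, x10, x11], mem'⟩) →
    Reaches W steinerProgram Q (k + 18 * enc.length)
      ⟨14, regs [len, ip, sp, tb, 1, x5, x6, x7, x8, x9, x10, x11], mem⟩

theorem evaluates_vertex (T : Finset ℕ) (v : ℕ) :
    Evaluates W T [v + 5] (if v ∈ T then (1, 1) else (0, 0)) := by
  intro len ip sp tb x5 x6 x7 x8 x9 x10 x11 mem k Q hr hip hsp htb hW hxW hT H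
  simp only [List.length_singleton, List.mem_singleton, forall_eq] at *
  refine (reaches_vertex hr.1 (hT v) (by omega) (by omega) (by omega) (by omega)
    (by split_ifs <;> omega) fun x5 x6 x7 => H _ _ _ _ _ _ _ _ ?_ ?_ ?_).mono (Nat.le_succ _)
  · intro a ha
    rw [Function.update_of_ne (by omega), Function.update_of_ne (by omega)]
  · rw [Function.update_of_ne (by omega), Function.update_self]
    split_ifs <;> rfl
  · rw [Function.update_self]
    split_ifs <;> rfl

/-- The left value occupies `sp` and `sp + 1`, the operation `sp + 2`, and the right value the next
two cells. Evaluation changes only cells in `[sp, tb)`, so the input, the table and the pending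
stack survive both recursive calls. -/
theorem Evaluates.binary {T : Finset ℕ} {l l' : List ℕ} {d d' : ℕ × ℕ} {op : ℕ}
    (h : Evaluates W T l d) (h' : Evaluates W T l' d') (h2 : 2 ≤ op) (h4 : op ≤ 4)
    (hd : d.1 ≤ d.2) (hd' : d'.1 ≤ d'.2) (hl : d.2 ≤ l.length) (hl' : d'.2 ≤ l'.length) :
    Evaluates W T ([0] ++ l ++ [op] ++ l' ++ [1]) (combine op d d', d.2 + d'.2) := by
  intro len ip sp tb x5 x6 x7 x8 x9 x10 x11 mem k Q hr hip hsp htb hW hxW hT H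
  have hlen : ([0] ++ l ++ [op] ++ l' ++ [1]).length = l.length + l'.length + 3 := by
    simp only [List.length_append, List.length_singleton]; omega
  rw [hlen] at hip htb ⊢
  simp only [hlen] at H
  simp only [reads_append, List.length_append, List.length_singleton] at hr
  obtain ⟨⟨⟨⟨hr0, hr1⟩, hr2⟩, hr3⟩, hr4⟩ := hr
  -- The three new symbols cost 5, 13 and 36 steps, together exactly `3 * 18`.
  refine Reaches.mono (k := k + 36 + 18 * l'.length + 13 + 18 * l.length + 5) ?_ (by omega)
  refine reaches_open hr0.1 (by omega) (by omega) fun x6 => ?_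
  refine h _ _ _ _ _ _ _ _ _ _ _ _ _ _ hr1 (by omega) hsp (by omega) hW
    (fun x hx => hxW x (by simp [hx])) hT ?_
  intro x5 x6 x7 x8 x9 x10 x11 mem₁ hm₁ hp₁ hn₁
  refine reaches_operation (op := op) ?_ h2 h4 (by omega) (by omega) (by omega) fun x6 x7 => ?_
  · rw [hm₁ _ (by omega)]
    convert hr2.1 using 2
    omega
  refine h' _ _ _ _ _ _ _ _ _ _ _ _ _ _ ?_ (by omega) (by omega) (by omega) hW
    (fun x hx => hxW x (by simp [hx])) ?_ ?_
  · rw [show ip + 1 + l.length + 1 = ip + (1 + l.length + 1) by omega]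
    refine hr3.congr fun x hx => ?_
    rw [Function.update_of_ne (by omega), hm₁ _ (by omega)]
  · intro v
    rw [Function.update_of_ne (by omega), hm₁ _ (by omega), hT]
  intro x5 x6 x7 x8 x9 x10 x11 mem₂ hm₂ hp₂ hn₂
  refine reaches_close (op := op) (d := d) (d' := d') (sp := sp) ?_ h2 h4 (by omega) (by omega)
    (by omega) ?_ ?_ ?_ hp₂ hn₂ hd hd' (by omega) ?_
  · rw [hm₂ _ (by omega), Function.update_of_ne (by omega), hm₁ _ (by omega)]
    convert hr4.1 using 2
    omega
  · rw [hm₂ _ (by omega), Function.update_of_ne (by omega), hp₁]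
  · rw [hm₂ _ (by omega), Function.update_of_ne (by omega), hn₁]
  · rw [hm₂ _ (by omega), Function.update_self]
  intro x5 x6 x7 x8 x9 x10 x11
  rw [show ip + 1 + l.length + 1 + l'.length + 1 = ip + (l.length + l'.length + 3) by omega]
  refine H _ _ _ _ _ _ _ _ ?_ ?_ ?_
  · intro a ha
    rw [Function.update_of_ne (by omega), Function.update_of_ne (by omega), hm₂ _ (by omega),
      Function.update_of_ne (by omega), hm₁ _ (by omega)]
  · rw [Function.update_of_ne (by omega), Function.update_self]
  · rw [Function.update_self]

end RAM

/-! ### Sizes of expressions and of their encodings -/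

namespace CoExpr

/-- A vertex takes one symbol and an operation three, and there is one vertex more than there are
operations. -/
theorem size_le_length_encode (e : CoExpr ℕ) :
    e.size ≤ e.encode.length ∧ e.encode.length + 1 ≤ 2 * e.size := by
  induction e with
  | vertex v => simp [size, encode]
  | union a b iha ihb | order a b iha ihb | series a b iha ihb =>
    simp only [size, encode, List.length_append, List.length_singleton]
    omega

theorem le_of_mem_encode (e : CoExpr ℕ) {N : ℕ} (hN : ∀ v ∈ e.graph.verts, v ≤ N) :
    ∀ x ∈ e.encode, x ≤ N + 5 := by
  induction e with
  | vertex v => simpa [encode, graph, FinDigraph.single] using hN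
  | union a b iha ihb | order a b iha ihb | series a b iha ihb =>
    have ha := iha fun v hv => hN v (Finset.mem_union_left _ hv)
    have hb := ihb fun v hv => hN v (Finset.mem_union_right _ hv)
    intro x hx
    simp only [encode, List.mem_append, List.mem_singleton] at hx
    rcases hx with (((rfl | hx) | rfl) | hx) | rfl
    exacts [by omega, ha x hx, by omega, hb x hx, by omega]

theorem evaluates_encode (W : ℕ) (T : Finset ℕ) (e : CoExpr ℕ) :
    RAM.Evaluates W T e.encode (e.coverData T) := by
  have hb := fun e : CoExpr ℕ =>
    And.intro (e.coverData_le T).1 ((e.coverData_le T).2.trans e.size_le_length_encode.1)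
  induction e with
  | vertex v => exact RAM.evaluates_vertex T v
  | union a b iha ihb =>
    exact iha.binary ihb (op := 2) (by omega) (by omega) (hb a).1 (hb b).1 (hb a).2 (hb b).2
  | order a b iha ihb =>
    exact iha.binary ihb (op := 3) (by omega) (by omega) (hb a).1 (hb b).1 (hb a).2 (hb b).2
  | series a b iha ihb =>
    exact iha.binary ihb (op := 4) (by omega) (by omega) (hb a).1 (hb b).1 (hb a).2 (hb b).2

theorem length_le_size {e : CoExpr ℕ} {l : List ℕ} (hl : l.Nodup)
    (h : ∀ v ∈ l, v ∈ e.graph.verts) : l.length ≤ e.size := by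
  have hc : e.graph.verts.card ≤ e.size := by
    clear h
    induction e with
    | vertex v => simp [graph, FinDigraph.single, size]
    | union a b iha ihb | order a b iha ihb | series a b iha ihb =>
      have : (a.graph.verts ∪ b.graph.verts).card ≤ _ := Finset.card_union_le _ _
      simp only [graph, FinDigraph.disjUnion, FinDigraph.orderComp, FinDigraph.seriesComp, size]
      omega
  rw [← List.toFinset_card_of_nodup hl]
  exact (Finset.card_le_card fun v hv => h v (by simpa using hv)).trans hc

end CoExpr

theorem mainTheorem8 :
    ∃ (P : List RAM.Instr) (c : ℕ),
      ∀ (e : CoExpr ℕ), e.Valid →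
      ∀ (T : Finset ℕ), T ⊆ e.graph.verts →
      ∀ (l : List ℕ), l.Nodup → l.toFinset = T →
      ∀ (N : ℕ), (∀ v ∈ e.graph.verts, v ≤ N) →
        ∃ m : ℕ,
          RAM.OutputsWithin P (c * (e.size + N)) (steinerInput l e) (c * e.size) m ∧
          IsLeast {k | ∃ C : Finset (List ℕ), e.graph.IsSteinerPathCover T C ∧
            k = C.card + FinDigraph.steinerCount T C} m := by
  -- A generous constant: the input has at most `3 * e.size` words, the table starts at three times
  -- the input length, and fewer than `44 * e.size` steps are needed.
  refine ⟨RAM.steinerProgram, 100, fun e he T hT l hl hlT N hN =>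
    ⟨(e.coverData T).1, ?_, e.isLeast_coverData T he hT⟩⟩
  have hmem : ∀ v, v ∈ l ↔ v ∈ T := fun v => by rw [← hlT, List.mem_toFinset]
  have hls := CoExpr.length_le_size (e := e) hl fun v hv => hT ((hmem v).1 hv)
  have hes := e.size_le_length_encode
  have hxe := e.le_of_mem_encode hN
  have hd := e.coverData_le T
  have hlN : ∀ t ∈ l, t ≤ N := fun t ht => hN t (hT ((hmem t).1 ht))
  have hlen : (steinerInput l e).length = l.length + e.encode.length + 1 := by
    simp [steinerInput]
  have hpos : 1 ≤ e.size := by cases e <;> simp [CoExpr.size]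
  generalize hW : 100 * (e.size + N) = W
  refine ⟨by omega, fun x hx => ?_, ?_⟩
  · simp only [steinerInput, List.mem_cons, List.mem_append] at hx
    rcases hx with rfl | hx | hx
    · omega
    · have := hlN x hx; omega
    · have := hxe x hx; omega
  have h0 : RAM.init (steinerInput l e) =
      ⟨0, RAM.regs [(steinerInput l e).length, 0, 0, 0, 0, 0, 0, 0, 0, 0, 0, 0],
        fun a => (steinerInput l e).getD a 0⟩ := by
    simp only [RAM.init, RAM.Config.mk.injEq, true_and, and_true]
    have : (fun _ => 0 : ℕ → ℕ) = RAM.regs [0, 0, 0, 0, 0, 0, 0, 0, 0, 0, 0, 0] := by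
      funext i
      rcases lt_or_ge i 12 with h | h
      · interval_cases i <;> rfl
      · simp [RAM.regs, h]
    rw [this, RAM.update_regs _ (by simp)]
    rfl
  rw [h0]
  have hr : RAM.Reads (fun a => (steinerInput l e).getD a 0) 0 (steinerInput l e) := by
    simpa using RAM.reads_getD (steinerInput l e) []
  obtain ⟨mem, hm⟩ : ∃ mem : ℕ → ℕ, mem = fun a => (steinerInput l e).getD a 0 := ⟨_, rfl⟩
  have hz : ∀ a, (steinerInput l e).length ≤ a → mem a = 0 := fun a ha => by
    rw [hm]; exact List.getD_eq_default _ _ ha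
  rw [← hm] at hr ⊢
  rw [hlen] at hz ⊢
  obtain ⟨hr0, hr⟩ := hr
  rw [RAM.reads_append] at hr
  simp only [zero_add] at hr
  generalize hq : l.length + e.encode.length + 1 = len at hz ⊢
  change RAM.Reaches W RAM.steinerProgram
    (fun s => RAM.steinerProgram[s.pc]? = some .halt ∧ s.reg 0 = (e.coverData T).1) _ _
  -- Six steps set up the registers, marking takes `8 * l.length + 1`, evaluation 18 per symbol, and
  -- three steps detect the end and fetch the result.
  refine RAM.Reaches.mono (k := 3 + 18 * e.encode.length + 1 + 8 * l.length + 6) ?_ (by omega)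
  refine RAM.reaches_const rfl (by simp) (by omega) ?_
  refine RAM.reaches_copy rfl (by simp) (by simp; omega) ?_
  refine RAM.reaches_add rfl (by simp) (by simp; omega) ?_
  refine RAM.reaches_add rfl (by simp) (by simp; omega) ?_
  refine RAM.reaches_load 0 l.length rfl (by simp) rfl hr0 (by omega) ?_
  refine RAM.reaches_copy rfl (by simp) (by simp; omega) ?_
  show RAM.Reaches W RAM.steinerProgram _ _
    ⟨6, RAM.regs [len, 1, len, len + len + len, 1, l.length, 0, 0, 0, 0, 0, 0], mem⟩
  refine RAM.reaches_mark l hr.1 rfl (by omega) (by omega)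
    (fun t ht => by have := hlN t ht; omega) fun x5 x6 mem₁ hm₁ => ?_
  refine e.evaluates_encode W T _ _ _ _ _ _ _ _ _ _ _ _ _ _ ?_ (by omega) le_rfl (by omega)
    (by omega) (fun x hx => by have := hxe x hx; omega) ?_ ?_
  · refine hr.2.congr fun x hx => ?_
    rw [hm₁, if_neg]
    rintro ⟨t, -, rfl⟩
    omega
  · intro v
    -- The table lies beyond the input, where memory is initially zero, so unmarked entries read 0.
    rw [hm₁, hz _ (by omega)]
    congr 1
    simp [hmem]
  intro x5 x6 x7 x8 x9 x10 x11 mem₂ hm₂ hp hn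
  refine RAM.reaches_sub rfl (by simp) (by simp; omega) ?_
  refine RAM.reaches_jumpZero_zero rfl (by simp; omega) ?_
  -- Register 0 still holds `len`, which is also the bottom of the stack, where the path number of
  -- the whole expression stands.
  refine RAM.reaches_load len _ rfl (by simp) (by simp) hp (by omega) ?_
  exact RAM.Reaches.of_holds ⟨rfl, rfl⟩ _
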